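/- Let $d\ge 3$, $\mathbb I=[0,1]$, let $\lambda_m$ be Lebesgue measure on $\mathbb I^m$ and $\lambda=\lambda_1$. A $d$-dimensional copula $C$ is the restriction to $\mathbb I^d$ of the distribution function of a probability measure $\mu_C$ on $\mathbb I^d$ with uniform one-dimensional marginals, i.e. $\mu_C([\mathbf 0,\mathbf x])=C(\mathbf x)$. A generator is a continuous, non-increasing function $\psi:[0,\infty)\to[0,1]$ with $\psi(0)=1$ and $\lim_{z\to\infty}\psi(z)=0=:\psi(\infty)$ that is strictly decreasing on $[0,\inf\{z\in[0,\infty]:\psi(z)=0\}]$; its pseudo-inverse is $\varphi(y)=\inf\{z\in[0,\infty]:\psi(z)=y\}$, $y\in[0,1]$. The copula $C$ is Archimedean with generator $\psi$ if $C(\mathbf x)=\psi(\varphi(x_1)+\dots+\varphi(x_d))$ for all $\mathbf x\in\mathbb I^d$. Its Williamson measure $\gamma$ is the probability measure on $\mathcal B([0,\infty))$ with $\gamma(\{0\})=0$ and $$\psi(z)=\int_{[0,\infty)}\big(\max(1-tz,0)\big)^{d-1}\,\mathrm d\gamma(t)\qquad(z>0);$$ it is assumed to be normalised by $\int_{[0,1]}(1-t)^{d-1}\,\mathrm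 d\gamma(t)=\tfrac12$ (equivalently $\psi(1)=\tfrac12$). Let $\mu_{C^{1:d-1}}$ be the marginal of $\mu_C$ in the first $d-1$ coordinates, and let $c^{1:d-1}$ be its density with respect to $\lambda_{d-1}$ (for an Archimedean copula with $d\ge 3$ this marginal is absolutely continuous). Let $K_C(\mathbf x,\cdot)$, $\mathbf x\in\mathbb I^{d-1}$, be any version of the regular conditional distribution under $\mu_C$ of the last coordinate given the first $d-1$ coordinates. Decompose $$K_C(\mathbf x,\cdot)=K_C^{dis}(\mathbf x,\cdot)+K_C^{sing}(\mathbf x,\cdot)+K_C^{abs}(\mathbf x,\cdot)$$ into the discrete part, the part that is singular with respect to $\lambda$ and has no point masses, and the absolutely continuous part. For $\ast\in\{dis,sing,abs\}$ and Borel $G\subseteq\mathbb I^d$ put $$\mu_C^{\ast}(G)=\int_{\mathbb I^{d-1}}K_C^{\ast}(\mathbf x,G_{\mathbf x})\,c^{1:d-1}(\mathbf x)\,\mathrm d\lambda_{d-1}(\mathbf x),\qquad G_{\mathbf x}=\{y\in\mathbb I:(\mathbf x,y)\in G\}.$$ **Theorem.** Let $C$ be a $d$-dimensional Archimedean copula with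 generator $\psi$ and Williamson measure $\gamma$. Then: 1. If $\gamma$ is absolutely continuous with respect to Lebesgue measure on $[0,\infty)$, then $\mu_C^{abs}(\mathbb I^d)=1$, and $C$ is absolutely continuous, i.e. $\mu_C\ll\lambda_d$. 2. If $\gamma$ is discrete (concentrated on a countable set), then $\mu_C^{dis}(\mathbb I^d)=1$. 3. If $\gamma$ is singular with respect to Lebesgue measure and has no point masses, then $\mu_C^{sing}(\mathbb I^d)=1$. -/

import Mathlib

open MeasureTheory ProbabilityTheory Set Filter Topology
open scoped ENNReal NNReal unitInterval

noncomputable section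

/-! ### Copulas and their `d`-stochastic measures -/

/-- A `d`-dimensional copula: the distribution function, on the cube `[0,1]^d`, of a probability
measure on the cube all of whose one-dimensional marginals are uniform on `[0,1]`. -/
structure Copula (d : ℕ) where
  toFun : (Fin d → I) → I
  exists_measure : ∃ μ : Measure (Fin d → I), IsProbabilityMeasure μ ∧
    (∀ i, μ.map (fun z => z i) = volume) ∧ ∀ x, μ.real (Iic x) = toFun x

namespace Copula

instance (d : ℕ) : CoeFun (Copula d) (fun _ => (Fin d → I) → I) := ⟨Copula.toFun⟩

/-- The `d`-stochastic measure `μ_C` of the copula `C`. It is characterised by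
`μ_C([0,x]) = C(x)`, see `measure_Iic` and `measure_unique`. -/
def measure {d : ℕ} (C : Copula d) : Measure (Fin d → I) := C.exists_measure.choose

instance {d : ℕ} (C : Copula d) : IsProbabilityMeasure C.measure :=
  C.exists_measure.choose_spec.1

theorem measure_Iic {d : ℕ} (C : Copula d) (x : Fin d → I) : C.measure.real (Iic x) = C x :=
  C.exists_measure.choose_spec.2.2 x

theorem map_eval_measure {d : ℕ} (C : Copula d) (i : Fin d) :
    C.measure.map (fun z => z i) = volume :=
  C.exists_measure.choose_spec.2.1 i

theorem measure_unique {d : ℕ} (C : Copula d) (μ : Measure (Fin d → I)) [IsProbabilityMeasure μ]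
    (h : ∀ x, μ.real (Iic x) = C x) : μ = C.measure := by
  have hgen : (MeasurableSpace.pi : MeasurableSpace (Fin d → I)) =
      MeasurableSpace.generateFrom (Set.pi univ '' Set.pi univ fun _ : Fin d => range Iic) := by
    refine (generateFrom_eq_pi (fun _ => ?_) fun _ => ?_).symm
    · rw [BorelSpace.measurable_eq (α := I), borel_eq_generateFrom_Iic]
    · refine ⟨fun _ => Iic 1, fun _ => ⟨1, rfl⟩, ?_⟩
      ext y
      simpa using unitInterval.le_one' (t := y)
  have hpi : IsPiSystem (Set.pi univ '' Set.pi univ fun _ : Fin d => range (Iic : I → Set I)) := by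
    refine IsPiSystem.pi fun _ => ?_
    rintro _ ⟨a, rfl⟩ _ ⟨b, rfl⟩ _
    exact ⟨a ⊓ b, Iic_inter_Iic.symm⟩
  refine ext_of_generate_finite _ hgen hpi ?_ (by simp)
  rintro _ ⟨s, hs, rfl⟩
  choose a ha using fun i => hs i (mem_univ i)
  have : Set.pi univ s = Iic a := by
    rw [← Set.pi_univ_Iic]
    exact Set.pi_congr rfl fun i _ => (ha i).symm
  rw [this, ← ENNReal.toReal_eq_toReal_iff' (measure_ne_top _ _) (measure_ne_top _ _)]
  exact (h a).trans (C.measure_Iic a).symm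

/-- `C` is absolutely continuous if `μ_C` is absolutely continuous with respect to the Lebesgue
measure on the cube. -/
def IsAbsolutelyContinuous {d : ℕ} (C : Copula d) : Prop := C.measure ≪ volume

end Copula

/-! ### Archimedean generators -/

/-- Extension of `ψ : [0,∞) → [0,1]` to `[0,∞]` by `ψ(∞) = 0`. -/
def extendGenerator (ψ : ℝ≥0 → I) (z : ℝ≥0∞) : I := if z = ∞ then 0 else ψ z.toNNReal

/-- `ψ` is an Archimedean generator: continuous and non-increasing with `ψ(0) = 1` and
`ψ(z) → 0` as `z → ∞`, and strictly decreasing on `[0, inf {z ∈ [0,∞] : ψ(z) = 0}]`. -/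
structure IsArchimedeanGenerator (ψ : ℝ≥0 → I) : Prop where
  continuous : Continuous ψ
  antitone : Antitone ψ
  map_zero : ψ 0 = 1
  tendsto_atTop : Tendsto ψ atTop (𝓝 0)
  strictAntiOn : StrictAntiOn (extendGenerator ψ) (Iic (sInf {z | extendGenerator ψ z = 0}))

/-- The pseudo-inverse `φ : [0,1] → [0,∞]` of `ψ`, `φ(y) = inf {z ∈ [0,∞] : ψ(z) = y}`. -/
def pseudoInverse (ψ : ℝ≥0 → I) (y : I) : ℝ≥0∞ := sInf {z | extendGenerator ψ z = y}

/-- `C` is the Archimedean copula with generator `ψ`: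
`C(x) = ψ(φ(x_1) + ... + φ(x_d))` for all `x` in the cube. -/
structure Copula.HasGenerator {d : ℕ} (C : Copula d) (ψ : ℝ≥0 → I) : Prop where
  isArchimedeanGenerator : IsArchimedeanGenerator ψ
  eq : ∀ x, C x = extendGenerator ψ (∑ i, pseudoInverse ψ (x i))

/-! ### Williamson measures -/

/-- `γ` is a `d`-Williamson measure: a probability measure on `[0,∞)` without mass at `0`,
normalised by `∫_{[0,1]} (1 - t)^{d-1} dγ(t) = 1/2`. -/
structure IsWilliamsonMeasure (d : ℕ) (γ : Measure ℝ≥0) : Prop where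
  isProbabilityMeasure : IsProbabilityMeasure γ
  measure_zero : γ {0} = 0
  normalized : ∫ t in Icc (0 : ℝ≥0) 1, (1 - (t : ℝ)) ^ (d - 1) ∂γ = 1 / 2

/-- The Williamson transform `z ↦ ∫ (1 - t z)_+^{d-1} dγ(t)`. -/
def williamsonTransform (d : ℕ) (γ : Measure ℝ≥0) (z : ℝ≥0) : ℝ :=
  ∫ t : ℝ≥0, max (1 - (t : ℝ) * z) 0 ^ (d - 1) ∂γ

/-- The Lebesgue measure on `[0,∞)`. -/
def lebesgueHalfLine : Measure ℝ≥0 := (volume : Measure ℝ).comap fun t : ℝ≥0 => (t : ℝ)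

/-- A measure is discrete if it is concentrated on a countable set. -/
def IsDiscreteMeasure {α : Type*} [MeasurableSpace α] (μ : Measure α) : Prop :=
  ∃ S : Set α, S.Countable ∧ μ Sᶜ = 0

/-! ### Decomposition of kernels -/

section Decomposition

variable {α : Type*} [MeasurableSpace α]

theorem measurableSet_kernel_atoms (K : Kernel α I) [IsFiniteKernel K] :
    MeasurableSet {p : α × I | K p.1 {p.2} = 0} := by
  have h := Kernel.measurable_kernel_prodMk_left (κ := K.comap (Prod.fst : α × I → α) measurable_fst)
    (t := {q : (α × I) × I | q.2 = q.1.2})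
    (measurableSet_eq_fun measurable_snd (measurable_snd.comp measurable_fst))
  exact h (measurableSet_singleton (0 : ℝ≥0∞))

theorem measurable_restrict_section (K : Kernel α I) [IsFiniteKernel K] {S : Set (α × I)}
    (hS : MeasurableSet S) : Measurable fun x => (K x).restrict {y | (x, y) ∈ S} := by
  refine Measure.measurable_of_measurable_coe _ fun s hs => ?_
  have h : ∀ x, (K x).restrict {y | (x, y) ∈ S} s = K x (Prod.mk x ⁻¹' (univ ×ˢ s ∩ S)) := by
    intro x
    rw [Measure.restrict_apply hs]
    congr 1
    ext y
    simp
  simp_rw [h]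
  exact Kernel.measurable_kernel_prodMk_left ((MeasurableSet.univ.prod hs).inter hS)

/-- The discrete part of a kernel: `K(x,·)` restricted to the set of its atoms. -/
def kernelDis (K : Kernel α I) [IsFiniteKernel K] : Kernel α I where
  toFun x := (K x).restrict {y | K x {y} ≠ 0}
  measurable' := measurable_restrict_section K (measurableSet_kernel_atoms K).compl

/-- The singular part of a kernel: the restriction of the Lebesgue-singular part of `K(x,·)` to the
set of points that are not atoms of `K(x,·)`. -/
def kernelSing (K : Kernel α I) [IsFiniteKernel K] : Kernel α I where
  toFun x := ((K x).singularPart volume).restrict {y | K x {y} = 0}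
  measurable' := by
    have h := measurable_restrict_section (Kernel.singularPart K (Kernel.const α volume))
      (measurableSet_kernel_atoms K)
    simp only [Kernel.singularPart_eq_singularPart_measure, Kernel.const_apply] at h
    exact h

/-- The absolutely continuous part of a kernel. -/
def kernelAbs (K : Kernel α I) [IsFiniteKernel K] : Kernel α I where
  toFun x := volume.withDensity ((K x).rnDeriv volume)
  measurable' := by
    have h := (Kernel.withDensity (Kernel.const α (volume : Measure I))
      (Kernel.rnDeriv K (Kernel.const α volume))).measurable
    have e : ∀ x, Kernel.withDensity (Kernel.const α (volume : Measure I))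
        (Kernel.rnDeriv K (Kernel.const α volume)) x =
        volume.withDensity ((K x).rnDeriv volume) := fun x => by
      rw [Kernel.withDensity_apply _ (Kernel.measurable_rnDeriv _ _), Kernel.const_apply]
      exact withDensity_congr_ae (Kernel.rnDeriv_eq_rnDeriv_measure (κ := K)
        (η := Kernel.const α volume) (a := x))
    exact (funext e) ▸ h

/-- `K = K^dis + K^sing + K^abs`, where each `K^dis(x,·)` is discrete, each `K^sing(x,·)` is
singular and has no point masses, and each `K^abs(x,·)` is absolutely continuous. -/
theorem kernel_decomposition (K : Kernel α I) [IsFiniteKernel K] :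
    K = kernelDis K + kernelSing K + kernelAbs K ∧
    ∀ x, IsDiscreteMeasure (kernelDis K x) ∧
      (kernelSing K x ⟂ₘ volume ∧ ∀ y, kernelSing K x {y} = 0) ∧
      kernelAbs K x ≪ volume := by
  have hm : ∀ x, MeasurableSet {y | K x {y} = 0} := fun x =>
    measurable_prodMk_left (measurableSet_kernel_atoms K)
  have hc : ∀ x, {y | K x {y} ≠ 0}.Countable := fun x => by
    simpa [pos_iff_ne_zero] using
      Measure.countable_meas_pos_of_disjoint_iUnion (μ := K x) (As := fun y : I => {y})
        (fun y => measurableSet_singleton y) (fun a b hab => by simpa using hab)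
  have hcompl : ∀ x, {y | K x {y} ≠ 0} = {y | K x {y} = 0}ᶜ := fun x => rfl
  refine ⟨?_, fun x => ⟨⟨_, hc x, ?_⟩, ⟨?_, fun y => ?_⟩, withDensity_absolutelyContinuous _ _⟩⟩
  · ext1 x
    change K x = (K x).restrict {y | K x {y} ≠ 0} +
      ((K x).singularPart volume).restrict {y | K x {y} = 0} +
      volume.withDensity ((K x).rnDeriv volume)
    have hac : volume.withDensity ((K x).rnDeriv volume) {y | K x {y} ≠ 0} = 0 :=
      withDensity_absolutelyContinuous _ _ ((hc x).measure_zero _)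
    have hd : (K x).restrict {y | K x {y} ≠ 0} =
        ((K x).singularPart volume).restrict {y | K x {y} ≠ 0} := by
      have h := congrArg (fun m => m.restrict {y | K x {y} ≠ 0})
        (Measure.haveLebesgueDecomposition_add (K x) volume)
      simp only [Measure.restrict_add, Measure.restrict_eq_zero.2 hac, add_zero] at h
      exact h
    rw [hd, hcompl, Measure.restrict_compl_add_restrict (hm x)]
    exact Measure.haveLebesgueDecomposition_add (K x) volume
  · change (K x).restrict {y | K x {y} ≠ 0} {y | K x {y} ≠ 0}ᶜ = 0
    rw [Measure.restrict_apply (hc x).measurableSet.compl]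
    simp
  · exact (Measure.mutuallySingular_singularPart _ _).restrict _
  · change ((K x).singularPart volume).restrict {y | K x {y} = 0} {y} = 0
    rw [Measure.restrict_apply (measurableSet_singleton y)]
    by_cases hy : K x {y} = 0
    · exact measure_mono_null inter_subset_left
        (le_antisymm ((Measure.singularPart_le _ _ _).trans hy.le) zero_le)
    · have he : {y} ∩ {y | K x {y} = 0} = ∅ := by
        ext z
        simp only [mem_inter_iff, mem_singleton_iff, mem_ofPred_eq, mem_empty_iff_false, iff_false]
        rintro ⟨rfl, hz⟩
        exact hy hz
      rw [he, measure_empty]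

end Decomposition

/-! ### Markov kernels of copulas and components of the `d`-stochastic measure

The dimension is `d = n + 1`; one conditions on the first `n = d - 1` coordinates. -/

namespace Copula

variable {n : ℕ}

/-- The `n`-stochastic measure `μ_{C^{1:n}}` of the marginal copula of the first `n` coordinates. -/
def measureInit (C : Copula (n + 1)) : Measure (Fin n → I) :=
  C.measure.map fun z i => z i.castSucc

/-- The Lebesgue density `c^{1:n}` of the marginal copula of the first `n` coordinates. -/
def densityInit (C : Copula (n + 1)) : (Fin n → I) → ℝ≥0∞ := C.measureInit.rnDeriv volume

/-- The Markov kernel `K` is (a version of) the `n`-Markov kernel of the copula `C`: a regular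
conditional distribution of the last coordinate given the first `n` coordinates under `μ_C`. -/
def HasMarkovKernel (C : Copula (n + 1)) (K : Kernel (Fin n → I) I) [IsMarkovKernel K] : Prop :=
  HasCondDistrib (fun z : Fin (n + 1) → I => z (Fin.last n)) (fun z i => z i.castSucc) K C.measure

/-- The component of `μ_C` that belongs to a part `K'` of the Markov kernel of `C`:
`G ↦ ∫ K'(x, G_x) c^{1:n}(x) dλ(x)` with the section `G_x = {y | (x,y) ∈ G}`. -/
def component (C : Copula (n + 1)) (K' : Kernel (Fin n → I) I) (G : Set (Fin (n + 1) → I)) : ℝ≥0∞ :=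
  ∫⁻ x, K' x {y | (Fin.snoc x y : Fin (n + 1) → I) ∈ G} * C.densityInit x

end Copula

end

/-! Write n = d - 1. If t has law γ and s is uniform on the corner simplex, then μ_C is the law of
the point with coordinates ψ(s_i / t) and ψ((1 - ∑ s_i) / t): given t, the event that this point
lies in [0,x] cuts out a simplex shrunk by the factor (1 - t ∑ φ(x_i))_+, and integrating the n-th
power over γ gives ψ(∑ φ(x_i)) = C(x) (`Copula.HasGenerator.measure_eq_map`).

The substitution y = s / t turns the last coordinate into ψ(1/t - ∑ y_i). Exchanging t and y by
Fubini shows that G is μ_C-null as soon as, for almost every x and γ-almost every t, the point (x,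
ψ(1/t - ∑ φ(x_i))) misses G (`Copula.HasGenerator.measure_eq_zero`). Here ψ, a mixture of convex
functions, is convex and strictly decreasing while positive, so it carries null sets to null sets in
both directions.

For fixed x the map t ↦ ψ(1/t - ∑ φ(x_i)) thus transports the type of γ to the last coordinate. If γ
≪ λ, Lebesgue-null sets have null sections and are therefore μ_C-null. If γ lives on S, then μ_C
lives on the points with 1 / ∑ φ(z_i) ∈ S, whose sections are countable or null when S is. If γ has
no atoms, the set of atoms of K(x,·), being countable, is missed. Disintegration transfers these
facts to K. -/

noncomputable section

/-! ### Generators and their pseudo-inverses -/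

namespace IsArchimedeanGenerator

variable {ψ : ℝ≥0 → I}

theorem lt_of_lt (h : IsArchimedeanGenerator ψ) {y z : ℝ≥0} (hyz : y < z) (hy : 0 < ψ y) :
    ψ z < ψ y := by
  rcases eq_or_ne (ψ z) 0 with hz | hz
  · rwa [hz]
  have key : ∀ w : ℝ≥0, ψ w ≠ 0 → (w : ℝ≥0∞) ∈ Iic (sInf {z | extendGenerator ψ z = 0}) := by
    intro w hw
    refine le_sInf fun u (hu : extendGenerator ψ u = 0) => ?_
    by_contra! hlt
    have hu' : u ≠ ∞ := (hlt.trans ENNReal.coe_lt_top).ne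
    lift u to ℝ≥0 using hu'
    have hu0 : ψ u = 0 := by simpa [extendGenerator] using hu
    have := h.antitone (ENNReal.coe_lt_coe.1 hlt).le
    rw [hu0] at this
    exact hw (le_antisymm this (unitInterval.nonneg' (t := ψ w)))
  simpa [extendGenerator] using
    h.strictAntiOn (key y hy.ne') (key z hz) (ENNReal.coe_lt_coe.2 hyz)

/-- Galois connection through which the infimum defining φ is handled; it rests on continuity of ψ
and the intermediate value theorem. -/
theorem pseudoInverse_le_iff (h : IsArchimedeanGenerator ψ) {x : I} {y : ℝ≥0} :
    pseudoInverse ψ x ≤ y ↔ ψ y ≤ x := by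
  constructor
  · intro hle
    by_contra! hlt
    -- Continuity yields z strictly beyond y with ψ z still above x; by monotonicity every preimage
    -- of x is at least z, so the infimum exceeds y.
    have hev : ∀ᶠ z in 𝓝[>] y, x < ψ z :=
      (h.continuous.continuousAt.eventually_const_lt hlt).filter_mono nhdsWithin_le_nhds
    obtain ⟨z, hz, hyz⟩ := (hev.and self_mem_nhdsWithin).exists
    have : (z : ℝ≥0∞) ≤ pseudoInverse ψ x := by
      refine le_sInf fun u hu => ?_
      by_contra! hlt
      have hu' : u ≠ ∞ := (hlt.trans ENNReal.coe_lt_top).ne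
      lift u to ℝ≥0 using hu'
      have hux : ψ u = x := by simpa [extendGenerator] using hu
      have := h.antitone (ENNReal.coe_lt_coe.1 hlt).le
      rw [hux] at this
      exact (hz.trans_le this).false
    exact (this.trans hle).not_gt (ENNReal.coe_lt_coe.2 hyz)
  · intro hle
    have hx : x ∈ Icc (ψ y) (ψ 0) := ⟨hle, by rw [h.map_zero]; exact unitInterval.le_one'⟩
    obtain ⟨z, hz, hzx⟩ :=
      intermediate_value_Icc' (zero_le (a := y)) h.continuous.continuousOn hx
    exact (sInf_le (by simpa [extendGenerator] using hzx)).trans (ENNReal.coe_le_coe.2 hz.2)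

theorem pseudoInverse_apply (h : IsArchimedeanGenerator ψ) {y : ℝ≥0} (hy : 0 < ψ y) :
    pseudoInverse ψ (ψ y) = y := by
  refine le_antisymm (h.pseudoInverse_le_iff.2 le_rfl) ?_
  by_contra! hlt
  obtain ⟨w, hw⟩ := WithTop.ne_top_iff_exists.1 (hlt.trans ENNReal.coe_lt_top).ne
  change (w : ℝ≥0∞) = _ at hw
  rw [← hw, ENNReal.coe_lt_coe] at hlt
  have hle : ψ w ≤ ψ y := h.pseudoInverse_le_iff.1 hw.symm.le
  exact (h.lt_of_lt hlt (hy.trans_le (h.antitone hlt.le))).not_ge hle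

theorem antitone_pseudoInverse (h : IsArchimedeanGenerator ψ) : Antitone (pseudoInverse ψ) := by
  intro x x' hx
  rcases eq_or_ne (pseudoInverse ψ x) ∞ with htop | htop
  · rw [htop]
    exact le_top
  lift pseudoInverse ψ x to ℝ≥0 using htop with r hr
  exact h.pseudoInverse_le_iff.2 ((h.pseudoInverse_le_iff.1 hr.symm.le).trans hx)

end IsArchimedeanGenerator

/-- The generator as a function on the real line, constant on `(-∞,0]`. -/
def generatorReal (ψ : ℝ≥0 → I) (y : ℝ) : I := ψ y.toNNReal

/-- The pseudo-inverse of a generator as a real function. -/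
def pseudoInverseReal (ψ : ℝ≥0 → I) (x : I) : ℝ := (pseudoInverse ψ x).toReal

namespace IsArchimedeanGenerator

variable {ψ : ℝ≥0 → I}

theorem continuous_generatorReal (h : IsArchimedeanGenerator ψ) : Continuous (generatorReal ψ) :=
  h.continuous.comp continuous_real_toNNReal

theorem antitone_generatorReal (h : IsArchimedeanGenerator ψ) : Antitone (generatorReal ψ) :=
  fun _ _ hxy => h.antitone (Real.toNNReal_le_toNNReal hxy)

theorem generatorReal_of_nonpos (h : IsArchimedeanGenerator ψ) {y : ℝ} (hy : y ≤ 0) :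
    generatorReal ψ y = 1 := by
  rw [generatorReal, Real.toNNReal_of_nonpos hy, h.map_zero]

theorem pos_of_generatorReal_lt_one (h : IsArchimedeanGenerator ψ) {y : ℝ}
    (hy : generatorReal ψ y < 1) : 0 < y := by
  by_contra! hle
  rw [h.generatorReal_of_nonpos hle] at hy
  exact hy.false

theorem generatorReal_lt_of_lt (h : IsArchimedeanGenerator ψ) {y z : ℝ} (hy0 : 0 ≤ y)
    (hyz : y < z) (hy : 0 < generatorReal ψ y) : generatorReal ψ z < generatorReal ψ y :=
  h.lt_of_lt ((Real.toNNReal_lt_toNNReal_iff (hy0.trans_lt hyz)).2 hyz) hy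

theorem measurable_pseudoInverseReal (h : IsArchimedeanGenerator ψ) :
    Measurable (pseudoInverseReal ψ) :=
  h.antitone_pseudoInverse.measurable.ennreal_toReal

theorem pseudoInverseReal_generatorReal (h : IsArchimedeanGenerator ψ) {y : ℝ}
    (hy : generatorReal ψ y ∈ Ioo 0 1) : pseudoInverseReal ψ (generatorReal ψ y) = y := by
  rw [pseudoInverseReal, generatorReal, h.pseudoInverse_apply hy.1, ENNReal.coe_toReal,
    Real.coe_toNNReal _ (h.pos_of_generatorReal_lt_one hy.2).le]

theorem pseudoInverse_ne_top (h : IsArchimedeanGenerator ψ) {x : I} (hx : 0 < x) :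
    pseudoInverse ψ x ≠ ∞ := by
  obtain ⟨y, hy⟩ := (h.tendsto_atTop.eventually_lt_const hx).exists
  exact ((h.pseudoInverse_le_iff.2 hy.le).trans_lt ENNReal.coe_lt_top).ne

theorem generatorReal_pseudoInverseReal (h : IsArchimedeanGenerator ψ) {x : I} (hx : 0 < x) :
    generatorReal ψ (pseudoInverseReal ψ x) = x := by
  have hne := h.pseudoInverse_ne_top hx
  rw [generatorReal, pseudoInverseReal, ENNReal.toReal, Real.toNNReal_coe]
  refine le_antisymm (h.pseudoInverse_le_iff.1 (ENNReal.coe_toNNReal hne).ge) ?_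
  have hx' : x ∈ Icc (0 : I) (ψ 0) :=
    ⟨hx.le, by rw [h.map_zero]; exact unitInterval.le_one'⟩
  obtain ⟨y, hy⟩ := (h.tendsto_atTop.eventually_lt_const hx).exists
  obtain ⟨z, -, hz⟩ := intermediate_value_Icc' (zero_le (a := y)) h.continuous.continuousOn
    (show x ∈ Icc (ψ y) (ψ 0) from ⟨hy.le, hx'.2⟩)
  rw [← hz, h.pseudoInverse_apply (hz ▸ hx), ENNReal.toNNReal_coe]

end IsArchimedeanGenerator

/-! ### Null sets under convex generators -/

/-- Chord slopes of a convex function increase, so to the left of b it falls at least as fast as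
over [b, c]. -/
theorem ConvexOn.neg_slope_mul_sub_le {f : ℝ → ℝ} {s : Set ℝ} (hf : ConvexOn ℝ s f)
    {y z b c : ℝ} (hy : y ∈ s) (hc : c ∈ s) (hyz : y < z) (hzb : z < b) (hbc : b < c) :
    (f b - f c) / (c - b) * (z - y) ≤ f y - f z := by
  have hz := hf.1.ordConnected.out hy hc ⟨hyz.le, (hzb.trans hbc).le⟩
  have hb := hf.1.ordConnected.out hy hc ⟨(hyz.trans hzb).le, hbc.le⟩
  have h3 := (hf.slope_mono_adjacent hy hb hyz hzb).trans (hf.slope_mono_adjacent hz hc hzb hbc)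
  rw [div_le_iff₀ (sub_pos.2 hyz)] at h3
  have : (f b - f c) / (c - b) = -((f c - f b) / (c - b)) := by ring
  rw [this]
  linarith

theorem LipschitzOnWith.volume_image_eq_zero {f : ℝ → ℝ} {s : Set ℝ} {k : ℝ≥0}
    (hf : LipschitzOnWith k f s) (hs : volume s = 0) : volume (f '' s) = 0 := by
  have := hf.hausdorffMeasure_image_le zero_le_one
  rw [hausdorffMeasure_real, hs, mul_zero] at this
  exact le_antisymm this zero_le

namespace IsArchimedeanGenerator

variable {ψ : ℝ≥0 → I}

/-- To the left of any b that precedes a strict drop of ψ, convexity bounds the rate of decrease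
away from 0, so the inverse is Lipschitz there and maps a null set to a null set. Countably many
rational pairs b < c suffice. -/
theorem volume_preimage_eq_zero (h : IsArchimedeanGenerator ψ)
    (hc : ConvexOn ℝ (Ici 0) fun y => (generatorReal ψ y : ℝ)) {B : Set I} (hB : volume B = 0) :
    volume {y : ℝ | generatorReal ψ y ∈ B ∧ generatorReal ψ y ∈ Ioo 0 1} = 0 := by
  set f := generatorReal ψ with hf
  have hcover : {y : ℝ | f y ∈ B ∧ f y ∈ Ioo 0 1} ⊆
      ⋃ (b : ℚ) (c : ℚ) (_ : (b : ℝ) < c ∧ f c < f b),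
        {y | (f y ∈ B ∧ f y ∈ Ioo 0 1) ∧ y < b} := by
    intro y hy
    have hev : ∀ᶠ z in 𝓝[>] y, 0 < f z :=
      (h.continuous_generatorReal.continuousAt.eventually_const_lt hy.2.1).filter_mono
        nhdsWithin_le_nhds
    obtain ⟨z, hz, hyz⟩ := (hev.and self_mem_nhdsWithin).exists
    obtain ⟨c, hyc, hcz⟩ := exists_rat_btwn hyz
    obtain ⟨b, hyb, hbc⟩ := exists_rat_btwn hyc
    have hb0 : 0 < f b := hz.trans_le (h.antitone_generatorReal (hbc.trans hcz).le)
    have hy0 := h.pos_of_generatorReal_lt_one hy.2.2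
    simp only [mem_iUnion]
    exact ⟨b, c, ⟨hbc, h.generatorReal_lt_of_lt (hy0.trans hyb).le hbc hb0⟩, hy, hyb⟩
  refine measure_mono_null hcover ?_
  simp only [measure_iUnion_null_iff]
  rintro b c ⟨hbc, hlt⟩
  set S : Set ℝ := {y | (f y ∈ B ∧ f y ∈ Ioo 0 1) ∧ y < b}
  set m : ℝ := ((f b : ℝ) - f c) / (c - b) with hm
  have hm0 : 0 < m := div_pos (sub_pos.2 hlt) (sub_pos.2 hbc)
  let g : ℝ → ℝ := fun u => pseudoInverseReal ψ (projIcc 0 1 zero_le_one u)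
  have hg : ∀ y ∈ S, g (f y) = y := fun y hy => by
    simp only [g, projIcc_val]
    exact h.pseudoInverseReal_generatorReal hy.1.2
  have key : ∀ y ∈ S, ∀ z ∈ S, y < z → m * (z - y) ≤ f y - f z := fun y hy z hz hyz =>
    hc.neg_slope_mul_sub_le (h.pos_of_generatorReal_lt_one hy.1.2.2).le
      (((h.pos_of_generatorReal_lt_one hy.1.2.2).trans (hyz.trans hz.2)).trans hbc).le
      hyz hz.2 hbc
  have hdist : ∀ y ∈ S, ∀ z ∈ S, m * |y - z| ≤ |(f y : ℝ) - f z| := by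
    intro y hy z hz
    rcases lt_trichotomy y z with hyz | rfl | hyz
    · rw [abs_sub_comm, abs_of_pos (sub_pos.2 hyz)]
      exact (key y hy z hz hyz).trans (le_abs_self _)
    · simp
    · rw [abs_of_pos (sub_pos.2 hyz), abs_sub_comm]
      exact (key z hz y hy hyz).trans (le_abs_self _)
  have hlip : LipschitzOnWith (m⁻¹).toNNReal g ((fun y => (f y : ℝ)) '' S) := by
    refine LipschitzOnWith.of_dist_le_mul ?_
    rintro _ ⟨y, hy, rfl⟩ _ ⟨z, hz, rfl⟩
    simp only [hg y hy, hg z hz, Real.coe_toNNReal _ (inv_pos.2 hm0).le, Real.dist_eq]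
    rw [inv_mul_eq_div, le_div_iff₀ hm0, mul_comm]
    exact hdist y hy z hz
  have hnull : volume ((fun y => (f y : ℝ)) '' S) = 0 := by
    rw [unitInterval.volume_apply] at hB
    refine measure_mono_null ?_ hB
    rintro _ ⟨y, hy, rfl⟩
    exact ⟨f y, hy.1.1, rfl⟩
  refine measure_mono_null ?_ (hlip.volume_image_eq_zero hnull)
  exact fun y hy => ⟨f y, ⟨y, hy, rfl⟩, hg y hy⟩

/-- The slope of ψ may be infinite at 0, but beyond a > 0 convexity makes ψ Lipschitz, with the
slope over [a/2, a] as constant. -/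
theorem volume_image_eq_zero (h : IsArchimedeanGenerator ψ)
    (hc : ConvexOn ℝ (Ici 0) fun y => (generatorReal ψ y : ℝ)) {A : Set ℝ} (hA : volume A = 0) :
    volume (generatorReal ψ '' (A ∩ Ioi 0)) = 0 := by
  set f := generatorReal ψ with hf
  have hcover : f '' (A ∩ Ioi 0) ⊆ ⋃ (a : ℚ) (_ : (0 : ℝ) < a), f '' (A ∩ Ioi (a : ℝ)) := by
    rintro _ ⟨y, ⟨hyA, hy⟩, rfl⟩
    obtain ⟨a, ha, hay⟩ := exists_rat_btwn (show (0 : ℝ) < y from hy)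
    simp only [mem_iUnion]
    exact ⟨a, ha, y, ⟨hyA, hay⟩, rfl⟩
  refine measure_mono_null hcover ?_
  simp only [measure_iUnion_null_iff]
  intro a ha
  rw [unitInterval.volume_apply, image_image]
  set k : ℝ := ((f (a / 2) : ℝ) - f a) / (a - a / 2) with hk
  have key : ∀ y ∈ A ∩ Ioi (a : ℝ), ∀ z ∈ A ∩ Ioi (a : ℝ), y < z →
      |(f y : ℝ) - f z| ≤ k * (z - y) := by
    intro y hy z hz hyz
    have ha' : (0 : ℝ) < a := ha
    have hya : (a : ℝ) < y := hy.2
    have h1 := hc.slope_mono_adjacent (x := a / 2) (y := a) (z := y)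
      (mem_Ici.2 (by linarith)) (mem_Ici.2 (by linarith)) (by linarith) hya
    have h2 := hc.slope_mono_adjacent (x := a) (y := y) (z := z)
      (mem_Ici.2 ha'.le) (mem_Ici.2 (by linarith)) hya hyz
    have h3 := h1.trans h2
    rw [le_div_iff₀ (sub_pos.2 hyz)] at h3
    have h4 : f z ≤ f y := h.antitone_generatorReal hyz.le
    have h5 : k = -(((f a : ℝ) - f (a / 2)) / (a - a / 2)) := by rw [hk]; ring
    rw [abs_of_nonneg (sub_nonneg.2 (Subtype.coe_le_coe.2 h4)), h5]
    linarith
  have hk0 : 0 ≤ k := by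
    have h4 : f a ≤ f (a / 2) := h.antitone_generatorReal (by linarith)
    exact div_nonneg (sub_nonneg.2 (Subtype.coe_le_coe.2 h4)) (by linarith)
  have hlip : LipschitzOnWith k.toNNReal (fun y => (f y : ℝ)) (A ∩ Ioi (a : ℝ)) := by
    refine LipschitzOnWith.of_dist_le_mul fun y hy z hz => ?_
    rw [Real.coe_toNNReal _ hk0, Real.dist_eq, Real.dist_eq]
    rcases lt_trichotomy y z with hyz | rfl | hyz
    · rw [abs_sub_comm y, abs_of_pos (sub_pos.2 hyz)]
      exact key y hy z hz hyz
    · simp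
    · rw [abs_of_pos (sub_pos.2 hyz), abs_sub_comm]
      exact key z hz y hy hyz
  exact hlip.volume_image_eq_zero (measure_mono_null inter_subset_left hA)

end IsArchimedeanGenerator

/-! ### Product measures and simplices -/

theorem MeasureTheory.Measure.AbsolutelyContinuous.pi_const {X : Type*} [MeasurableSpace X]
    {μ ν : Measure X} [SigmaFinite μ] [SigmaFinite ν] (h : μ ≪ ν) (n : ℕ) :
    Measure.pi (fun _ : Fin n => μ) ≪ Measure.pi (fun _ : Fin n => ν) := by
  induction n with
  | zero =>
    rw [Measure.pi_of_empty, Measure.pi_of_empty]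
  | succ n ih =>
    have hμ := (measurePreserving_piFinSuccAbove (fun _ : Fin (n + 1) => μ) 0).symm
    have hν := (measurePreserving_piFinSuccAbove (fun _ : Fin (n + 1) => ν) 0).symm
    rw [← hμ.map_eq, ← hν.map_eq]
    exact (h.prod ih).map hμ.measurable

/-- The simplex `{s | 0 ≤ s, ∑ s_i ≤ 1}`. -/
def cornerSimplex (n : ℕ) : Set (Fin n → ℝ) := {s | (∀ i, 0 ≤ s i) ∧ ∑ i, s i ≤ 1}

section Simplex

variable {n : ℕ}

theorem measurableSet_cornerSimplex : MeasurableSet (cornerSimplex n) := by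
  unfold cornerSimplex
  measurability

theorem volume_cornerSimplex_ne_top : volume (cornerSimplex n) ≠ ∞ := by
  have hsub : cornerSimplex n ⊆ Icc (0 : Fin n → ℝ) 1 := fun s hs => ⟨hs.1, fun i => ?_⟩
  · exact measure_ne_top_of_subset hsub isCompact_Icc.measure_lt_top.ne
  exact (Finset.single_le_sum (f := s) (fun j _ => hs.1 j) (Finset.mem_univ i)).trans hs.2

theorem volume_cornerSimplex_ne_zero : volume (cornerSimplex n) ≠ 0 := by
  have hsub : Icc (0 : Fin n → ℝ) (fun _ => (n + 1 : ℝ)⁻¹) ⊆ cornerSimplex n := by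
    refine fun s hs => ⟨hs.1, (Finset.sum_le_sum fun i _ => hs.2 i).trans ?_⟩
    simp only [Finset.sum_const, Finset.card_univ, Fintype.card_fin, nsmul_eq_mul]
    rw [mul_inv_le_iff₀ (by positivity)]
    linarith
  refine (lt_of_lt_of_le ?_ (measure_mono hsub)).ne'
  rw [Real.volume_Icc_pi]
  simp only [Pi.zero_apply, sub_zero]
  exact pos_iff_ne_zero.2 (Finset.prod_ne_zero_iff.2 fun i _ =>
    (ENNReal.ofReal_pos.2 (by positivity)).ne')

theorem volume_shifted_simplex (hn : n ≠ 0) (a : Fin n → ℝ) (b : ℝ) :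
    volume {s : Fin n → ℝ | (∀ i, a i ≤ s i) ∧ ∑ i, s i ≤ b} =
      ENNReal.ofReal (max (b - ∑ i, a i) 0 ^ n) * volume (cornerSimplex n) := by
  have : Nonempty (Fin n) := ⟨⟨0, Nat.pos_of_ne_zero hn⟩⟩
  set r := b - ∑ i, a i with hr
  have hshift : {s : Fin n → ℝ | (∀ i, a i ≤ s i) ∧ ∑ i, s i ≤ b} =
      (fun s => s + -a) ⁻¹' {s | (∀ i, 0 ≤ s i) ∧ ∑ i, s i ≤ r} := by
    ext s
    simp [hr, ← sub_eq_add_neg]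
  rw [hshift, measure_preimage_add_right]
  -- Only r > 0 is a genuine dilation of the corner simplex. In the other two cases both sides
  -- vanish, which needs n ≠ 0 because of 0 ^ 0 = 1.
  rcases lt_trichotomy r 0 with h | h | h
  · have : {s : Fin n → ℝ | (∀ i, 0 ≤ s i) ∧ ∑ i, s i ≤ r} = ∅ := by
      refine eq_empty_of_forall_notMem fun s hs => ?_
      exact (h.trans_le (Finset.sum_nonneg fun i _ => hs.1 i)).not_ge hs.2
    rw [this, max_eq_right h.le, zero_pow hn]
    simp
  · have : {s : Fin n → ℝ | (∀ i, 0 ≤ s i) ∧ ∑ i, s i ≤ r} ⊆ {0} := by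
      intro s hs
      have h0 := (Finset.sum_eq_zero_iff_of_nonneg fun i _ => hs.1 i).1
        (le_antisymm (hs.2.trans h.le) (Finset.sum_nonneg fun i _ => hs.1 i))
      exact funext fun i => h0 i (Finset.mem_univ i)
    rw [measure_mono_null this (measure_singleton _), h, max_self, zero_pow hn]
    simp
  · have : {s : Fin n → ℝ | (∀ i, 0 ≤ s i) ∧ ∑ i, s i ≤ r} =
        (fun s => r⁻¹ • s) ⁻¹' cornerSimplex n := by
      ext s
      simp only [cornerSimplex, mem_ofPred_eq, mem_preimage, Pi.smul_apply, smul_eq_mul,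
        ← Finset.mul_sum, mul_nonneg_iff_of_pos_left (inv_pos.2 h)]
      rw [inv_mul_le_iff₀ h, mul_one]
    rw [this, Measure.addHaar_preimage_smul _ (inv_ne_zero h.ne'), max_eq_left h.le,
      Module.finrank_fin_fun, inv_pow, inv_inv, abs_of_pos (pow_pos h n)]

end Simplex

/-! ### The stochastic representation of an Archimedean copula -/

/-- The point of the cube whose generator coordinates are `s_i / t` and `(1 - ∑ s_i) / t`. -/
def simplexPoint {n : ℕ} (ψ : ℝ≥0 → I) (p : ℝ≥0 × (Fin n → ℝ)) : Fin (n + 1) → I :=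
  Fin.snoc (fun i => generatorReal ψ (p.2 i / p.1)) (generatorReal ψ ((1 - ∑ i, p.2 i) / p.1))

/-- The uniform distribution on the simplex. -/
def simplexMeasure (n : ℕ) : Measure (Fin n → ℝ) := volume[|cornerSimplex n]

instance (n : ℕ) : IsProbabilityMeasure (simplexMeasure n) :=
  cond_isProbabilityMeasure_of_finite volume_cornerSimplex_ne_zero volume_cornerSimplex_ne_top

theorem measurable_snoc {α : Type*} [MeasurableSpace α] {n : ℕ} {f : α → Fin n → I} {g : α → I}
    (hf : Measurable f) (hg : Measurable g) :
    Measurable fun x => (Fin.snoc (f x) (g x) : Fin (n + 1) → I) := by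
  refine measurable_pi_iff.2 fun i => ?_
  induction i using Fin.lastCases with
  | last => simpa using hg
  | cast i => simpa using measurable_pi_iff.1 hf i

namespace IsArchimedeanGenerator

variable {n : ℕ} {ψ : ℝ≥0 → I}

theorem measurable_simplexPoint (h : IsArchimedeanGenerator ψ) :
    Measurable (simplexPoint (n := n) ψ) := by
  have hm := h.continuous_generatorReal.measurable
  refine measurable_snoc (measurable_pi_iff.2 fun i => hm.comp ?_) (hm.comp ?_) <;> fun_prop

theorem generatorReal_le_iff (h : IsArchimedeanGenerator ψ) {x : I} (hx : pseudoInverse ψ x ≠ ∞)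
    {y : ℝ} (hy : 0 ≤ y) : generatorReal ψ y ≤ x ↔ pseudoInverseReal ψ x ≤ y := by
  rw [generatorReal, ← h.pseudoInverse_le_iff, pseudoInverseReal, ← ENNReal.ofReal,
    ENNReal.le_ofReal_iff_toReal_le hx hy]

/-- The first n constraints become s_i ≥ t φ(x_i), the last becomes an upper bound on ∑ s_i;
together they describe a shifted, shrunken simplex. -/
theorem simplexMeasure_simplexPoint_le (h : IsArchimedeanGenerator ψ) (hn : n ≠ 0) {t : ℝ≥0}
    (ht : 0 < t) {x : Fin (n + 1) → I} (hx : ∀ i, pseudoInverse ψ (x i) ≠ ∞) :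
    simplexMeasure n {s | simplexPoint ψ (t, s) ≤ x} =
      ENNReal.ofReal (max (1 - (t : ℝ) * ∑ i, pseudoInverseReal ψ (x i)) 0 ^ n) := by
  have ht' : (0 : ℝ) < t := ht
  have hset : cornerSimplex n ∩ {s | simplexPoint ψ (t, s) ≤ x} =
      {s | (∀ i : Fin n, (t : ℝ) * pseudoInverseReal ψ (x i.castSucc) ≤ s i) ∧
        ∑ i, s i ≤ 1 - t * pseudoInverseReal ψ (x (Fin.last n))} := by
    ext s
    simp only [mem_inter_iff, mem_ofPred_eq, Pi.le_def, Fin.forall_fin_succ', simplexPoint,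
      Fin.snoc_castSucc, Fin.snoc_last]
    constructor
    · rintro ⟨⟨h0, h1⟩, h2, h3⟩
      refine ⟨fun i => ?_, ?_⟩
      · have := (h.generatorReal_le_iff (hx _) (div_nonneg (h0 i) ht'.le)).1 (h2 i)
        rwa [le_div_iff₀' ht'] at this
      · have := (h.generatorReal_le_iff (hx _) (div_nonneg (sub_nonneg.2 h1) ht'.le)).1 h3
        rw [le_div_iff₀' ht'] at this
        linarith
    · rintro ⟨h2, h3⟩
      have hp : ∀ i, 0 ≤ (t : ℝ) * pseudoInverseReal ψ (x i) := fun i =>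
        mul_nonneg ht'.le ENNReal.toReal_nonneg
      have h0 : ∀ i, 0 ≤ s i := fun i => (hp _).trans (h2 i)
      have h1 : ∑ i, s i ≤ 1 := h3.trans (by linarith [hp (Fin.last n)])
      refine ⟨⟨h0, h1⟩, fun i => ?_, ?_⟩
      · rw [h.generatorReal_le_iff (hx _) (div_nonneg (h0 i) ht'.le), le_div_iff₀' ht']
        exact h2 i
      · rw [h.generatorReal_le_iff (hx _) (div_nonneg (sub_nonneg.2 h1) ht'.le), le_div_iff₀' ht']
        linarith
  rw [simplexMeasure, cond_apply measurableSet_cornerSimplex, hset, volume_shifted_simplex hn,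
    mul_comm, mul_assoc, ENNReal.mul_inv_cancel volume_cornerSimplex_ne_zero
      volume_cornerSimplex_ne_top, mul_one, Fin.sum_univ_castSucc, mul_add, Finset.mul_sum]
  congr 3
  ring

/-- Treated apart because the real-valued pseudo-inverse sends ∞ to 0; here ψ never gets down to the
value x_i. -/
theorem simplexMeasure_simplexPoint_le_of_eq_top (h : IsArchimedeanGenerator ψ) {t : ℝ≥0}
    {x : Fin (n + 1) → I} {i : Fin (n + 1)} (hx : pseudoInverse ψ (x i) = ∞) :
    {s | simplexPoint ψ (t, s) ≤ x} = ∅ := by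
  refine eq_empty_of_forall_notMem fun s hs => ?_
  have key : ∀ y : ℝ, ¬ generatorReal ψ y ≤ x i := fun y hy => by
    have := h.pseudoInverse_le_iff.2 hy
    rw [hx] at this
    exact ENNReal.coe_ne_top (top_le_iff.1 this)
  have hi := hs i
  induction i using Fin.lastCases with
  | last => exact key _ (by simpa [simplexPoint] using hi)
  | cast i => exact key _ (by simpa [simplexPoint] using hi)

end IsArchimedeanGenerator

/-! ### Williamson transforms -/

section Williamson

variable {γ : Measure ℝ≥0} [IsProbabilityMeasure γ]

theorem williamson_integrand_mem_Icc (n : ℕ) {t z : ℝ} (ht : 0 ≤ t) (hz : 0 ≤ z) :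
    max (1 - t * z) 0 ^ n ∈ Icc (0 : ℝ) 1 :=
  ⟨by positivity, pow_le_one₀ (le_max_right _ _)
    (max_le (by linarith [mul_nonneg ht hz]) zero_le_one)⟩

theorem integrable_williamson (n : ℕ) {z : ℝ} (hz : 0 ≤ z) :
    Integrable (fun t : ℝ≥0 => max (1 - (t : ℝ) * z) 0 ^ n) γ := by
  refine Integrable.of_bound (C := 1) (by fun_prop) (ae_of_all _ fun t => ?_)
  have := williamson_integrand_mem_Icc n t.2 hz
  exact (abs_of_nonneg this.1).trans_le this.2

theorem convexOn_williamson (n : ℕ) :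
    ConvexOn ℝ (Ici 0) fun z : ℝ => ∫ t : ℝ≥0, max (1 - (t : ℝ) * z) 0 ^ n ∂γ := by
  have hconv : ∀ t : ℝ≥0, ConvexOn ℝ (Ici 0) fun z : ℝ => max (1 - (t : ℝ) * z) 0 ^ n := by
    intro t
    have h1 : ConvexOn ℝ (Ici 0) fun z : ℝ => 1 - (t : ℝ) * z := by
      refine ⟨convex_Ici 0, fun x _ y _ a b _ _ hab => le_of_eq ?_⟩
      simp only [smul_eq_mul]
      linear_combination (-1 : ℝ) * hab
    have h2 := h1.sup (convexOn_const 0 (convex_Ici 0))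
    exact h2.pow (fun _ _ => le_max_right _ _) n
  refine ⟨convex_Ici 0, fun x hx y hy a b ha hb hab => ?_⟩
  simp only [smul_eq_mul]
  rw [← integral_const_mul, ← integral_const_mul, ← integral_add
    ((integrable_williamson n hx).const_mul a) ((integrable_williamson n hy).const_mul b)]
  refine integral_mono (integrable_williamson n ?_)
    (((integrable_williamson n hx).const_mul a).add ((integrable_williamson n hy).const_mul b))
    fun t => ?_
  · exact add_nonneg (mul_nonneg ha hx) (mul_nonneg hb hy)
  · simpa using (hconv t).2 hx hy ha hb hab

end Williamson

section Representation

variable {n : ℕ} {ψ : ℝ≥0 → I} {γ : Measure ℝ≥0}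

theorem IsArchimedeanGenerator.eq_williamsonTransform (h : IsArchimedeanGenerator ψ)
    (hγ : IsWilliamsonMeasure (n + 1) γ)
    (hψγ : ∀ z : ℝ≥0, 0 < z → (ψ z : ℝ) = williamsonTransform (n + 1) γ z) (z : ℝ≥0) :
    (ψ z : ℝ) = williamsonTransform (n + 1) γ z := by
  have := hγ.isProbabilityMeasure
  rcases eq_or_ne z 0 with rfl | hz
  · simp [williamsonTransform, h.map_zero]
  · exact hψγ z (pos_iff_ne_zero.2 hz)

theorem IsArchimedeanGenerator.convexOn_generatorReal (h : IsArchimedeanGenerator ψ)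
    (hγ : IsWilliamsonMeasure (n + 1) γ)
    (hψγ : ∀ z : ℝ≥0, 0 < z → (ψ z : ℝ) = williamsonTransform (n + 1) γ z) :
    ConvexOn ℝ (Ici 0) fun y => (generatorReal ψ y : ℝ) := by
  have := hγ.isProbabilityMeasure
  refine (convexOn_williamson (γ := γ) n).congr fun y hy => ?_
  rw [generatorReal, h.eq_williamsonTransform hγ hψγ, williamsonTransform,
    Real.coe_toNNReal _ hy, Nat.add_sub_cancel]

theorem IsWilliamsonMeasure.ae_pos {d : ℕ} (hγ : IsWilliamsonMeasure d γ) : ∀ᵐ t ∂γ, 0 < t := by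
  have : ∀ᵐ t ∂γ, t ≠ 0 := by
    rw [ae_iff]
    simpa using hγ.measure_zero
  filter_upwards [this] with t ht using pos_iff_ne_zero.2 ht

theorem Copula.HasGenerator.measure_eq_map {C : Copula (n + 1)} (hn : n ≠ 0)
    (hC : C.HasGenerator ψ) (hγ : IsWilliamsonMeasure (n + 1) γ)
    (hψγ : ∀ z : ℝ≥0, 0 < z → (ψ z : ℝ) = williamsonTransform (n + 1) γ z) :
    C.measure = (γ.prod (simplexMeasure n)).map (simplexPoint ψ) := by
  have := hγ.isProbabilityMeasure
  have h := hC.isArchimedeanGenerator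
  have hm := h.measurable_simplexPoint (n := n)
  have := Measure.isProbabilityMeasure_map (μ := γ.prod (simplexMeasure n)) hm.aemeasurable
  refine (C.measure_unique _ fun x => ?_).symm
  rw [measureReal_def, Measure.map_apply hm measurableSet_Iic,
    Measure.prod_apply (hm measurableSet_Iic), hC.eq]
  by_cases hx : ∀ i, pseudoInverse ψ (x i) ≠ ∞
  · have hint : ∫⁻ t, simplexMeasure n (Prod.mk t ⁻¹' (simplexPoint ψ ⁻¹' Iic x)) ∂γ =
        ENNReal.ofReal (∫ t : ℝ≥0,
          max (1 - (t : ℝ) * ∑ i, pseudoInverseReal ψ (x i)) 0 ^ n ∂γ) := by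
      have hz : 0 ≤ ∑ i, pseudoInverseReal ψ (x i) :=
        Finset.sum_nonneg fun i _ => ENNReal.toReal_nonneg
      rw [ofReal_integral_eq_lintegral_ofReal (integrable_williamson n hz)
        (ae_of_all _ fun t => (williamson_integrand_mem_Icc n t.2 hz).1)]
      refine lintegral_congr_ae ?_
      filter_upwards [hγ.ae_pos] with t ht
      exact h.simplexMeasure_simplexPoint_le hn ht hx
    have hsum : ∑ i, pseudoInverse ψ (x i) ≠ ∞ := ENNReal.sum_ne_top.2 fun i _ => hx i
    have hsum' : ∑ i, pseudoInverseReal ψ (x i) =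
        ((∑ i, pseudoInverse ψ (x i)).toNNReal : ℝ) := by
      rw [ENNReal.coe_toNNReal_eq_toReal, ENNReal.toReal_sum fun i _ => hx i]
      rfl
    rw [hint, ENNReal.toReal_ofReal (integral_nonneg fun t => by positivity), extendGenerator,
      if_neg hsum, h.eq_williamsonTransform hγ hψγ, williamsonTransform, hsum',
      Nat.add_sub_cancel]
  · push Not at hx
    obtain ⟨i, hi⟩ := hx
    have hempty : ∀ t : ℝ≥0, Prod.mk t ⁻¹' (simplexPoint ψ ⁻¹' Iic x) = ∅ := fun t =>
      h.simplexMeasure_simplexPoint_le_of_eq_top hi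
    have hsum : ∑ i, pseudoInverse ψ (x i) = ∞ :=
      ENNReal.sum_eq_top.2 ⟨i, Finset.mem_univ i, hi⟩
    simp [hempty, hsum, extendGenerator]

end Representation

/-! ### Null sets of an Archimedean copula -/

theorem Copula.ae_mem_Ioo {d : ℕ} (C : Copula d) : ∀ᵐ z ∂C.measure, ∀ i, z i ∈ Ioo (0 : I) 1 := by
  refine ae_all_iff.2 fun i => ?_
  have hnull : ∀ᵐ u : I, u ∈ Ioo (0 : I) 1 := by
    rw [ae_iff]
    refine measure_mono_null (t := {0} ∪ {1}) (fun u hu => ?_)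
      (measure_union_null (measure_singleton _) (measure_singleton _))
    by_contra hne
    simp only [mem_union, mem_singleton_iff, not_or] at hne
    exact hu ⟨unitInterval.pos_iff_ne_zero.2 hne.1, unitInterval.lt_one_iff_ne_one.2 hne.2⟩
  rw [← C.map_eval_measure i] at hnull
  exact ae_of_ae_map (measurable_pi_apply i).aemeasurable hnull

/-- The one-dimensional null-set statement, read as absolute continuity of a pushforward, passes to
products. -/
theorem IsArchimedeanGenerator.ae_generatorReal_notMem {n : ℕ} {ψ : ℝ≥0 → I}
    (h : IsArchimedeanGenerator ψ) (hc : ConvexOn ℝ (Ici 0) fun y => (generatorReal ψ y : ℝ))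
    {B : Set (Fin n → I)} (hB : volume B = 0) :
    ∀ᵐ y : Fin n → ℝ, (∀ i, generatorReal ψ (y i) ∈ Ioo 0 1) →
      (fun i => generatorReal ψ (y i)) ∉ B := by
  set f := generatorReal ψ with hf
  have hfm : Measurable f := h.continuous_generatorReal.measurable
  set D : Set ℝ := f ⁻¹' Ioo 0 1 with hD
  -- A finite measure with the same null sets keeps the pushforward finite, so that its product
  -- powers are available.
  set ρ : Measure ℝ := (volume.restrict D).toFinite
  have hDm : MeasurableSet D := hfm measurableSet_Ioo
  have hmap : ρ.map f ≪ volume := by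
    refine Measure.AbsolutelyContinuous.mk fun s hs h0 => ?_
    rw [Measure.map_apply hfm hs]
    refine toFinite_absolutelyContinuous _ ?_
    rw [Measure.restrict_apply (hfm hs)]
    exact h.volume_preimage_eq_zero hc h0
  have hfin : IsFiniteMeasure (ρ.map f) := Measure.isFiniteMeasure_map _ _
  have hpi : (Measure.pi fun _ : Fin n => ρ).map (fun y i => f (y i)) ≪ volume := by
    rw [Measure.pi_map_pi fun _ => hfm.aemeasurable]
    exact hmap.pi_const n
  have hm : Measurable fun (y : Fin n → ℝ) i => f (y i) :=
    measurable_pi_iff.2 fun i => hfm.comp (measurable_pi_apply i)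
  have h1 : ∀ᵐ y ∂(Measure.pi fun _ : Fin n => ρ), (fun i => f (y i)) ∉ B := by
    refine ae_of_ae_map (f := fun (y : Fin n → ℝ) i => f (y i)) (p := fun x => x ∉ B)
      hm.aemeasurable (hpi.ae_le (measure_eq_zero_iff_ae_notMem.1 hB))
  have h2 : (volume : Measure (Fin n → ℝ)).restrict (Set.pi univ fun _ => D) ≪
      Measure.pi fun _ : Fin n => ρ := by
    rw [volume_pi, Measure.restrict_pi_pi]
    exact Measure.AbsolutelyContinuous.pi_const (absolutelyContinuous_toFinite _) n
  have h3 : ∀ᵐ y : Fin n → ℝ ∂volume.restrict (Set.pi univ fun _ => D), (fun i => f (y i)) ∉ B :=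
    h2.ae_le h1
  rw [ae_restrict_iff' (MeasurableSet.univ_pi fun _ => hDm)] at h3
  filter_upwards [h3] with y hy hyD using hy fun i _ => hyD i

section NullSets

variable {n : ℕ} {ψ : ℝ≥0 → I} {γ : Measure ℝ≥0}

/-- The criterion behind all three cases: the hypothesis fixes x first and lets t vary, whereas the
representation fixes t first. -/
theorem Copula.HasGenerator.measure_eq_zero {C : Copula (n + 1)} (hn : n ≠ 0)
    (hC : C.HasGenerator ψ) (hγ : IsWilliamsonMeasure (n + 1) γ)
    (hψγ : ∀ z : ℝ≥0, 0 < z → (ψ z : ℝ) = williamsonTransform (n + 1) γ z)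
    {G : Set (Fin (n + 1) → I)} (hG : MeasurableSet G)
    (hnull : ∀ᵐ x : Fin n → I, ∀ᵐ t : ℝ≥0 ∂γ,
      generatorReal ψ ((t : ℝ)⁻¹ - ∑ i, pseudoInverseReal ψ (x i)) ∈ Ioo 0 1 →
      (Fin.snoc x (generatorReal ψ ((t : ℝ)⁻¹ - ∑ i, pseudoInverseReal ψ (x i))) :
        Fin (n + 1) → I) ∉ G) :
    C.measure G = 0 := by
  have := hγ.isProbabilityMeasure
  have h := hC.isArchimedeanGenerator
  have hfm : Measurable (generatorReal ψ) := h.continuous_generatorReal.measurable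
  -- The faces of the cube are null by uniformity of the marginals; off them φ(ψ(y)) = y.
  set G' : Set (Fin (n + 1) → I) := G ∩ {z | ∀ i, z i ∈ Ioo (0 : I) 1} with hG'
  have hGm : MeasurableSet G' := by
    refine hG.inter ?_
    rw [ofPred_forall]
    exact MeasurableSet.iInter fun i => measurable_pi_apply i measurableSet_Ioo
  have hGG : C.measure G' = C.measure G := by
    refine measure_congr ?_
    filter_upwards [C.ae_mem_Ioo] with z hz
    exact propext ⟨fun h => h.1, fun h => ⟨h, hz⟩⟩
  have hsm := h.measurable_simplexPoint (n := n)
  rw [← hGG, hC.measure_eq_map hn hγ hψγ, Measure.map_apply hsm hGm,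
    Measure.measure_prod_null (hsm hGm)]
  have hyt : ∀ᵐ y : Fin n → ℝ, ∀ᵐ t : ℝ≥0 ∂γ, (Fin.snoc (fun i => generatorReal ψ (y i))
      (generatorReal ψ ((t : ℝ)⁻¹ - ∑ i, y i)) : Fin (n + 1) → I) ∉ G' := by
    filter_upwards [h.ae_generatorReal_notMem (h.convexOn_generatorReal hγ hψγ)
      (ae_iff.1 hnull)] with y hy
    by_cases hyD : ∀ i, generatorReal ψ (y i) ∈ Ioo 0 1
    · have hy' := not_not.1 (hy hyD)
      simp only [fun i => h.pseudoInverseReal_generatorReal (hyD i)] at hy'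
      filter_upwards [hy'] with t ht hmem
      exact ht (by simpa using hmem.2 (Fin.last n)) hmem.1
    · refine ae_of_all _ fun t hmem => hyD fun i => ?_
      simpa using hmem.2 i.castSucc
  have hmeas : MeasurableSet {p : (Fin n → ℝ) × ℝ≥0 |
      (Fin.snoc (fun i => generatorReal ψ (p.1 i))
        (generatorReal ψ ((p.2 : ℝ)⁻¹ - ∑ i, p.1 i)) : Fin (n + 1) → I) ∉ G'} := by
    refine (measurable_snoc (measurable_pi_iff.2 fun i => hfm.comp ?_)
      (hfm.comp ?_) hGm).compl <;> fun_prop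
  have hty := (Measure.ae_ae_comm hmeas).1 hyt
  filter_upwards [hty, hγ.ae_pos] with t ht ht0
  have ht0' : (t : ℝ) ≠ 0 := (show (0 : ℝ) < t from ht0).ne'
  -- The uniform law on the simplex is dominated by Lebesgue measure, and the dilation s ↦ s / t
  -- respects null sets.
  refine cond_absolutelyContinuous ?_
  have hset : Prod.mk t ⁻¹' (simplexPoint ψ ⁻¹' G') = (fun s => (t : ℝ)⁻¹ • s) ⁻¹' {y |
      (Fin.snoc (fun i => generatorReal ψ (y i))
        (generatorReal ψ ((t : ℝ)⁻¹ - ∑ i, y i)) : Fin (n + 1) → I) ∈ G'} := by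
    ext s
    simp only [mem_preimage, simplexPoint, mem_ofPred_eq, Pi.smul_apply, smul_eq_mul,
      ← Finset.mul_sum, div_eq_inv_mul, mul_one, mul_sub]
  rw [hset, Measure.addHaar_preimage_smul _ (inv_ne_zero ht0')]
  have hzero := ae_iff.1 ht
  simp only [not_not] at hzero
  rw [hzero, mul_zero]

end NullSets

/-! ### Sections along the last coordinate -/

section Sections

variable {ψ : ℝ≥0 → I} {γ : Measure ℝ≥0}

theorem lebesgueHalfLine_apply (s : Set ℝ≥0) :
    lebesgueHalfLine s = volume ((fun t : ℝ≥0 => (t : ℝ)) '' s) :=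
  (MeasurableEmbedding.subtype_coe measurableSet_Ici).comap_apply _ _

theorem volume_image_inv_eq_zero {A : Set ℝ} (hA : volume A = 0) (hpos : A ⊆ Ioi 0) :
    volume ((fun u => u⁻¹) '' A) = 0 :=
  addHaar_image_eq_zero_of_differentiableOn_of_addHaar_eq_zero _
    (fun _ hu => (differentiableAt_inv (hpos hu).ne').differentiableWithinAt) hA

theorem IsArchimedeanGenerator.eq_inv_of_mem_Ioo (h : IsArchimedeanGenerator ψ) {t : ℝ≥0} {r : ℝ}
    (ht : generatorReal ψ ((t : ℝ)⁻¹ - r) ∈ Ioo 0 1) :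
    (t : ℝ) = (pseudoInverseReal ψ (generatorReal ψ ((t : ℝ)⁻¹ - r)) + r)⁻¹ := by
  rw [h.pseudoInverseReal_generatorReal ht, sub_add_cancel, inv_inv]

/-- The bad t are reciprocals of points in a shifted null set. Since r ≥ 0, that set lies in (0, ∞),
where inversion is differentiable. -/
theorem IsArchimedeanGenerator.ae_notMem_of_absolutelyContinuous (h : IsArchimedeanGenerator ψ)
    (hc : ConvexOn ℝ (Ici 0) fun y => (generatorReal ψ y : ℝ)) (hγ : γ ≪ lebesgueHalfLine)
    {B : Set I} (hB : volume B = 0) {r : ℝ} (hr : 0 ≤ r) :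
    ∀ᵐ t : ℝ≥0 ∂γ, generatorReal ψ ((t : ℝ)⁻¹ - r) ∈ Ioo 0 1 →
      generatorReal ψ ((t : ℝ)⁻¹ - r) ∉ B := by
  rw [ae_iff]
  refine hγ ?_
  rw [lebesgueHalfLine_apply]
  set D := {y : ℝ | generatorReal ψ y ∈ B ∧ generatorReal ψ y ∈ Ioo 0 1}
  have hD : volume D = 0 := h.volume_preimage_eq_zero hc hB
  have hD' : volume ((fun u => u - r) ⁻¹' D) = 0 := by
    simpa only [sub_eq_add_neg, measure_preimage_add_right] using hD
  refine measure_mono_null ?_ (volume_image_inv_eq_zero hD' fun u hu => ?_)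
  · rintro _ ⟨t, ht, rfl⟩
    simp only [mem_ofPred_eq, Classical.not_imp, not_not] at ht
    exact ⟨(t : ℝ)⁻¹, ⟨ht.2, ht.1⟩, inv_inv _⟩
  · have := h.pos_of_generatorReal_lt_one hu.2.2
    exact mem_Ioi.2 (by linarith)

theorem IsArchimedeanGenerator.ae_notMem_of_countable (h : IsArchimedeanGenerator ψ)
    (hγ : ∀ t, γ {t} = 0) {B : Set I} (hB : B.Countable) (r : ℝ) :
    ∀ᵐ t : ℝ≥0 ∂γ, generatorReal ψ ((t : ℝ)⁻¹ - r) ∈ Ioo 0 1 →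
      generatorReal ψ ((t : ℝ)⁻¹ - r) ∉ B := by
  rw [ae_iff]
  have : NullSingletonClass γ := ⟨hγ⟩
  refine measure_mono_null ?_
    ((hB.image fun x => ((pseudoInverseReal ψ x + r)⁻¹).toNNReal).measure_zero γ)
  intro t ht
  simp only [mem_ofPred_eq, Classical.not_imp, not_not] at ht
  refine ⟨_, ht.2, ?_⟩
  simp only [← h.eq_inv_of_mem_Ioo ht.1, Real.toNNReal_coe]

/-- The points of the cube that correspond to the levels `t ∈ S` of the Williamson measure. -/
def levelSet {d : ℕ} (ψ : ℝ≥0 → I) (S : Set ℝ≥0) : Set (Fin d → I) :=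
  {z | ((∑ i, pseudoInverseReal ψ (z i))⁻¹).toNNReal ∈ S}

theorem IsArchimedeanGenerator.measurableSet_levelSet {d : ℕ} (h : IsArchimedeanGenerator ψ)
    {S : Set ℝ≥0} (hS : MeasurableSet S) : MeasurableSet (levelSet (d := d) ψ S) := by
  refine Measurable.real_toNNReal (Measurable.inv ?_) hS
  exact Finset.measurable_sum _ fun i _ =>
    h.measurable_pseudoInverseReal.comp (measurable_pi_apply i)

theorem Copula.HasGenerator.measure_compl_levelSet {n : ℕ} {C : Copula (n + 1)} (hn : n ≠ 0)
    (hC : C.HasGenerator ψ) (hγ : IsWilliamsonMeasure (n + 1) γ)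
    (hψγ : ∀ z : ℝ≥0, 0 < z → (ψ z : ℝ) = williamsonTransform (n + 1) γ z)
    {S : Set ℝ≥0} (hS : MeasurableSet S) (hγS : γ Sᶜ = 0) :
    C.measure (levelSet ψ S)ᶜ = 0 := by
  have h := hC.isArchimedeanGenerator
  refine hC.measure_eq_zero hn hγ hψγ (h.measurableSet_levelSet hS).compl (ae_of_all _ fun x => ?_)
  filter_upwards [mem_ae_iff.2 hγS] with t htS ht
  simp only [levelSet, mem_compl_iff, mem_ofPred_eq, not_not, Fin.sum_univ_castSucc,
    Fin.snoc_castSucc, Fin.snoc_last, h.pseudoInverseReal_generatorReal ht, add_sub_cancel,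
    inv_inv, Real.toNNReal_coe]
  exact htS

/-- For 0 < y < 1 the level t satisfies φ(y) = 1/t - ∑ φ(x_i), hence y is determined by t. The
endpoints, where default values may intervene, are simply added. -/
theorem IsArchimedeanGenerator.section_levelSet_subset {n : ℕ} (h : IsArchimedeanGenerator ψ)
    (S : Set ℝ≥0) (x : Fin n → I) :
    {y | (Fin.snoc x y : Fin (n + 1) → I) ∈ levelSet ψ S} ⊆
      generatorReal ψ '' ((fun t : ℝ≥0 => (t : ℝ)⁻¹ - ∑ i, pseudoInverseReal ψ (x i)) ''
        (S ∩ Ioi 0) ∩ Ioi 0) ∪ {0, 1} := by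
  intro y hy
  by_cases hy01 : y ∈ ({0, 1} : Set I)
  · exact Or.inr hy01
  simp only [mem_insert_iff, mem_singleton_iff, not_or] at hy01
  have hy0 : 0 < y := unitInterval.pos_iff_ne_zero.2 hy01.1
  have hy1 : y < 1 := unitInterval.lt_one_iff_ne_one.2 hy01.2
  have hφ := h.generatorReal_pseudoInverseReal hy0
  have hpos : 0 < pseudoInverseReal ψ y := h.pos_of_generatorReal_lt_one (by rwa [hφ])
  have hr : 0 ≤ ∑ i, pseudoInverseReal ψ (x i) :=
    Finset.sum_nonneg fun i _ => ENNReal.toReal_nonneg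
  simp only [levelSet, mem_ofPred_eq, Fin.sum_univ_castSucc, Fin.snoc_castSucc,
    Fin.snoc_last] at hy
  have hinv : 0 < (∑ i, pseudoInverseReal ψ (x i) + pseudoInverseReal ψ y)⁻¹ := by positivity
  refine Or.inl ⟨pseudoInverseReal ψ y, ⟨⟨_, ⟨hy, Real.toNNReal_pos.2 hinv⟩, ?_⟩, hpos⟩, hφ⟩
  simp only [Real.coe_toNNReal _ hinv.le, inv_inv, add_sub_cancel_left]

theorem IsArchimedeanGenerator.countable_section_levelSet {n : ℕ} (h : IsArchimedeanGenerator ψ)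
    {S : Set ℝ≥0} (hS : S.Countable) (x : Fin n → I) :
    {y | (Fin.snoc x y : Fin (n + 1) → I) ∈ levelSet ψ S}.Countable := by
  refine Countable.mono (h.section_levelSet_subset S x) (Countable.union ?_ (by simp))
  exact (((hS.mono inter_subset_left).image _).mono inter_subset_left).image _

theorem IsArchimedeanGenerator.volume_section_levelSet {n : ℕ} (h : IsArchimedeanGenerator ψ)
    (hc : ConvexOn ℝ (Ici 0) fun y => (generatorReal ψ y : ℝ)) {S : Set ℝ≥0}
    (hS : lebesgueHalfLine S = 0) (x : Fin n → I) :
    volume {y | (Fin.snoc x y : Fin (n + 1) → I) ∈ levelSet ψ S} = 0 := by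
  refine measure_mono_null (h.section_levelSet_subset S x) (measure_union_null
    (h.volume_image_eq_zero hc ?_) ((toFinite {0, 1}).measure_zero _))
  rw [lebesgueHalfLine_apply] at hS
  have hpos : (fun t : ℝ≥0 => (t : ℝ)) '' (S ∩ Ioi 0) ⊆ Ioi 0 := by
    rintro _ ⟨t, ht, rfl⟩
    exact NNReal.coe_pos.2 ht.2
  have hinv := volume_image_inv_eq_zero
    (measure_mono_null (image_mono inter_subset_left) hS) hpos
  set r := ∑ i, pseudoInverseReal ψ (x i)
  have hshift := (measure_preimage_add_right volume r _).trans hinv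
  refine measure_mono_null ?_ hshift
  rintro _ ⟨t, ht, rfl⟩
  exact ⟨t, ⟨t, ht, rfl⟩, (sub_add_cancel _ _).symm⟩

end Sections

/-! ### Disintegration along the last coordinate -/

section Disintegration

variable {n : ℕ}

theorem measurePreserving_init_last :
    MeasurePreserving (fun z : Fin (n + 1) → I => ((fun i => z (Fin.castSucc i) : Fin n → I),
      z (Fin.last n))) volume (volume.prod volume) := by
  have h := (Measure.measurePreserving_swap (μ := (volume : Measure I))
    (ν := (volume : Measure (Fin n → I)))).comp
    (volume_preserving_piFinSuccAbove (fun _ : Fin (n + 1) => I) (Fin.last n))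
  have heq : (fun z : Fin (n + 1) → I => ((fun i => z (Fin.castSucc i) : Fin n → I),
      z (Fin.last n))) =
      Prod.swap ∘ MeasurableEquiv.piFinSuccAbove (fun _ : Fin (n + 1) => I) (Fin.last n) := by
    funext z
    refine Prod.ext (funext fun i => ?_) rfl
    change _ = z ((Fin.last n).succAbove i)
    rw [Fin.succAbove_last]
  rw [heq]
  exact h

theorem measurable_init_last :
    Measurable (fun z : Fin (n + 1) → I => ((fun i => z (Fin.castSucc i) : Fin n → I),
      z (Fin.last n))) := by
  fun_prop

theorem snoc_castSucc_last (z : Fin (n + 1) → I) :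
    (Fin.snoc (fun i => z (Fin.castSucc i)) (z (Fin.last n)) : Fin (n + 1) → I) = z :=
  Fin.snoc_init_self z

theorem ae_volume_section_eq_zero {G : Set (Fin (n + 1) → I)} (hG : MeasurableSet G)
    (h0 : volume G = 0) :
    ∀ᵐ x : Fin n → I, volume {y | (Fin.snoc x y : Fin (n + 1) → I) ∈ G} = 0 := by
  have hm : MeasurableSet {p : (Fin n → I) × I | (Fin.snoc p.1 p.2 : Fin (n + 1) → I) ∈ G} :=
    measurable_snoc measurable_fst measurable_snd hG
  refine (Measure.measure_prod_null hm).1 ?_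
  rw [← measurePreserving_init_last.measure_preimage hm.nullMeasurableSet]
  simpa only [preimage_ofPred_eq, snoc_castSucc_last, ofPred_mem_eq] using h0

namespace Copula

instance (C : Copula (n + 1)) : IsProbabilityMeasure C.measureInit :=
  Measure.isProbabilityMeasure_map measurable_init_last.fst.aemeasurable

variable {C : Copula (n + 1)} {K : Kernel (Fin n → I) I} [IsMarkovKernel K]

theorem HasMarkovKernel.map_eq_compProd (hK : C.HasMarkovKernel K) :
    C.measure.map (fun z => ((fun i => z (Fin.castSucc i) : Fin n → I), z (Fin.last n))) =
      C.measureInit ⊗ₘ K :=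
  HasLaw.map_eq hK

theorem HasMarkovKernel.ae_section_eq_zero (hK : C.HasMarkovKernel K)
    {G : Set (Fin (n + 1) → I)} (hG : MeasurableSet G) (h0 : C.measure G = 0) :
    ∀ᵐ x ∂C.measureInit, K x {y | (Fin.snoc x y : Fin (n + 1) → I) ∈ G} = 0 := by
  have hm : MeasurableSet {p : (Fin n → I) × I | (Fin.snoc p.1 p.2 : Fin (n + 1) → I) ∈ G} :=
    measurable_snoc measurable_fst measurable_snd hG
  have h : (C.measureInit ⊗ₘ K)
      {p : (Fin n → I) × I | (Fin.snoc p.1 p.2 : Fin (n + 1) → I) ∈ G} = 0 := by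
    rw [← hK.map_eq_compProd, Measure.map_apply measurable_init_last hm]
    simpa only [preimage_ofPred_eq, snoc_castSucc_last, ofPred_mem_eq] using h0
  rw [Measure.compProd_apply hm, lintegral_eq_zero_iff (Kernel.measurable_kernel_prodMk_left hm)]
    at h
  exact h

theorem HasMarkovKernel.ae_absolutelyContinuous (hK : C.HasMarkovKernel K)
    (hC : C.IsAbsolutelyContinuous) : ∀ᵐ x ∂C.measureInit, K x ≪ volume := by
  have h := Measure.AbsolutelyContinuous.map hC (measurable_init_last (n := n))
  rw [hK.map_eq_compProd, measurePreserving_init_last.map_eq, ← Measure.compProd_const] at h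
  simpa using h.kernel_of_compProd

/-- By absolute continuity, integrating against the density is integrating against the marginal
itself. -/
theorem component_univ_eq_one (hC : C.measureInit ≪ volume) {K' : Kernel (Fin n → I) I}
    (hK' : ∀ᵐ x ∂C.measureInit, K' x univ = 1) : C.component K' univ = 1 := by
  have hm : Measurable fun x => K' x univ := K'.measurable_coe MeasurableSet.univ
  simp only [component, densityInit, mem_univ, ofPred_true, mul_comm (K' _ univ)]
  have : C.measureInit.HaveLebesgueDecomposition volume :=
    Measure.haveLebesgueDecomposition_of_sigmaFinite _ _
  rw [lintegral_rnDeriv_mul hC hm.aemeasurable, lintegral_congr_ae hK']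
  simp

end Copula

end Disintegration

/-! ### Parts of a kernel of full mass -/

section Parts

variable {α : Type*} [MeasurableSpace α] {K : Kernel α I} [IsMarkovKernel K] {x : α}

theorem kernelAbs_univ_eq_one (h : K x ≪ volume) : kernelAbs K x univ = 1 := by
  change volume.withDensity ((K x).rnDeriv volume) univ = 1
  rw [Measure.withDensity_rnDeriv_eq _ _ h, measure_univ]

theorem kernelDis_univ_eq_one {S : Set I} (hS : S.Countable) (h : K x Sᶜ = 0) :
    kernelDis K x univ = 1 := by
  change (K x).restrict {y | K x {y} ≠ 0} univ = 1
  have hm : MeasurableSet {y | K x {y} = 0} := measurable_prodMk_left (measurableSet_kernel_atoms K)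
  rw [Measure.restrict_apply_univ]
  refine (prob_compl_eq_zero_iff hm.compl).1 ?_
  rw [compl_compl]
  -- A non-atom is outside S or one of the countably many null singletons of S.
  refine measure_mono_null (t := Sᶜ ∪ ⋃ y ∈ {y ∈ S | K x {y} = 0}, {y}) (fun y hy => ?_)
    (measure_union_null h ((measure_biUnion_null_iff (hS.mono (sep_subset _ _))).2
      fun y hy => hy.2))
  by_cases hyS : y ∈ S
  · exact Or.inr (mem_biUnion (⟨hyS, hy⟩ : y ∈ {y ∈ S | K x {y} = 0}) rfl)
  · exact Or.inl hyS

theorem kernelSing_univ_eq_one (h : K x ⟂ₘ volume) (h0 : ∀ y, K x {y} = 0) :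
    kernelSing K x univ = 1 := by
  change ((K x).singularPart volume).restrict {y | K x {y} = 0} univ = 1
  rw [Measure.singularPart_eq_self.2 h]
  simp [h0]

end Parts

/-! ### Regularity of Archimedean copulas -/

namespace Copula.HasGenerator

variable {n : ℕ} {C : Copula (n + 1)} {ψ : ℝ≥0 → I} {γ : Measure ℝ≥0}

theorem measureInit_absolutelyContinuous (hn : n ≠ 0) (hC : C.HasGenerator ψ)
    (hγ : IsWilliamsonMeasure (n + 1) γ)
    (hψγ : ∀ z : ℝ≥0, 0 < z → (ψ z : ℝ) = williamsonTransform (n + 1) γ z) :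
    C.measureInit ≪ volume := by
  refine Measure.AbsolutelyContinuous.mk fun B hB h0 => ?_
  have hm : Measurable fun (z : Fin (n + 1) → I) (i : Fin n) => z i.castSucc := by fun_prop
  rw [Copula.measureInit, Measure.map_apply hm hB]
  -- Membership in the cylinder over B does not depend on t, so almost every x works for all t.
  refine hC.measure_eq_zero hn hγ hψγ (hm hB) ?_
  filter_upwards [measure_eq_zero_iff_ae_notMem.1 h0] with x hx
  exact ae_of_all _ fun t _ => by simpa using hx

theorem isAbsolutelyContinuous (hn : n ≠ 0) (hC : C.HasGenerator ψ)
    (hγ : IsWilliamsonMeasure (n + 1) γ)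
    (hψγ : ∀ z : ℝ≥0, 0 < z → (ψ z : ℝ) = williamsonTransform (n + 1) γ z)
    (hac : γ ≪ lebesgueHalfLine) : C.IsAbsolutelyContinuous := by
  have h := hC.isArchimedeanGenerator
  refine Measure.AbsolutelyContinuous.mk fun G hG h0 => ?_
  refine hC.measure_eq_zero hn hγ hψγ hG ?_
  filter_upwards [ae_volume_section_eq_zero hG h0] with x hx
  exact h.ae_notMem_of_absolutelyContinuous (h.convexOn_generatorReal hγ hψγ) hac hx
    (Finset.sum_nonneg fun i _ => ENNReal.toReal_nonneg)

variable {K : Kernel (Fin n → I) I} [IsMarkovKernel K]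

theorem ae_kernel_singleton_eq_zero (hn : n ≠ 0) (hC : C.HasGenerator ψ)
    (hγ : IsWilliamsonMeasure (n + 1) γ)
    (hψγ : ∀ z : ℝ≥0, 0 < z → (ψ z : ℝ) = williamsonTransform (n + 1) γ z)
    (hK : C.HasMarkovKernel K) (hat : ∀ t, γ {t} = 0) :
    ∀ᵐ x ∂C.measureInit, ∀ y, K x {y} = 0 := by
  -- The pairs (x, y) with y an atom of K(x,·) have countable sections, so an atomless γ makes them
  -- μ_C-null; disintegrating, K(x,·) gives no mass to its own atoms.
  have hG : MeasurableSet {z : Fin (n + 1) → I |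
      K (fun i => z (Fin.castSucc i)) {z (Fin.last n)} ≠ 0} :=
    measurable_init_last (measurableSet_kernel_atoms K).compl
  have h0 := hC.measure_eq_zero hn hγ hψγ hG (ae_of_all _ fun x => ?_)
  · filter_upwards [hK.ae_section_eq_zero hG h0] with x hx y
    by_contra hy
    refine hy (measure_mono_null (singleton_subset_iff.2 ?_) hx)
    simpa using hy
  · have hcount : {y | K x {y} ≠ 0}.Countable := by
      simpa [pos_iff_ne_zero] using
        Measure.countable_meas_pos_of_disjoint_iUnion (μ := K x) (As := fun y : I => {y})
          (fun y => measurableSet_singleton y) (fun a b hab => by simpa using hab)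
    simpa using hC.isArchimedeanGenerator.ae_notMem_of_countable hat hcount
      (∑ i, pseudoInverseReal ψ (x i))

end Copula.HasGenerator

end

theorem mainTheorem5 (n : ℕ) (hn : 2 ≤ n) (C : Copula (n + 1)) (ψ : ℝ≥0 → I)
    (hψ : C.HasGenerator ψ) (γ : Measure ℝ≥0) (hγ : IsWilliamsonMeasure (n + 1) γ)
    (hψγ : ∀ z : ℝ≥0, 0 < z → (ψ z : ℝ) = williamsonTransform (n + 1) γ z)
    (K : Kernel (Fin n → I) I) [IsMarkovKernel K] (hK : C.HasMarkovKernel K) :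
    (γ ≪ lebesgueHalfLine → C.component (kernelAbs K) univ = 1 ∧ C.IsAbsolutelyContinuous) ∧
    (IsDiscreteMeasure γ → C.component (kernelDis K) univ = 1) ∧
    (γ ⟂ₘ lebesgueHalfLine → (∀ t, γ {t} = 0) → C.component (kernelSing K) univ = 1) := by
  have hn0 : n ≠ 0 := by omega
  have h := hψ.isArchimedeanGenerator
  have hinit := hψ.measureInit_absolutelyContinuous hn0 hγ hψγ
  refine ⟨fun hac => ?_, fun ⟨S, hS, hγS⟩ => ?_, fun hsing hat => ?_⟩
  · have hC := hψ.isAbsolutelyContinuous hn0 hγ hψγ hac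
    refine ⟨Copula.component_univ_eq_one hinit ?_, hC⟩
    filter_upwards [hK.ae_absolutelyContinuous hC] with x hx using kernelAbs_univ_eq_one hx
  · have h0 := hψ.measure_compl_levelSet hn0 hγ hψγ hS.measurableSet hγS
    refine Copula.component_univ_eq_one hinit ?_
    filter_upwards [hK.ae_section_eq_zero (h.measurableSet_levelSet hS.measurableSet).compl h0]
      with x hx
    exact kernelDis_univ_eq_one (h.countable_section_levelSet hS x) hx
  -- Here S is the γ-null set and its complement is Lebesgue-null, so the relevant levels are those
  -- in Sᶜ.
  · obtain ⟨S, hS, hγS, hvol⟩ := hsing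
    have hc := h.convexOn_generatorReal hγ hψγ
    have h0 := hψ.measure_compl_levelSet hn0 hγ hψγ hS.compl (by rwa [compl_compl])
    have hm := h.measurableSet_levelSet (d := n + 1) hS.compl
    refine Copula.component_univ_eq_one hinit ?_
    filter_upwards [hK.ae_section_eq_zero hm.compl h0,
      hψ.ae_kernel_singleton_eq_zero hn0 hγ hψγ hK hat] with x hx hx0
    refine kernelSing_univ_eq_one ⟨_, ?_, hx, ?_⟩ hx0
    · exact measurable_snoc measurable_const measurable_id hm.compl
    · exact measure_mono_null (fun y hy => not_not.1 hy) (h.volume_section_levelSet hc hvol x)
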